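/- Let $c>0$, $\lambda>0$, $0<p<1$, and let $d_j=(\cos(\pi j/2),\sin(\pi j/2))$, with indices $j$ modulo $4$. A particle starts at the origin at time $0$ and moves in the plane at constant speed $c$; its initial direction $D(0)$ is uniformly distributed on $\{d_0,d_1,d_2,d_3\}$, and its direction $D(t)$ switches at the events of a homogeneous Poisson process of intensity $\lambda$. At each switch, independently of the Poisson process and of the past, a horizontal direction $d_j$ ($j=0,2$) turns to $d_{j+1}$ with probability $p$ and to $d_{j-1}$ with probability $1-p$, while a vertical direction $d_j$ ($j=1,3$) turns to $d_{j+1}$ with probability $1-p$ and to $d_{j-1}$ with probability $p$. Let $(X(t),Y(t))$ be the position at time $t$, that is $(X(t),Y(t))=c\int_0^t D(s)\,ds$. Let $I_0(x)=\sum_{k\ge 0}\frac{(x/2)^{2k}}{(k!)^2}$ be the modified Bessel function of the first kind of order zero. Then for every $t>0$ the distribution of $X(t)-Y(t)$ on the event $X(t)+Y(t)=ct$ has on the interval $|\eta|<ct$ the density $$g(\eta,t)=\frac{e^{-\lambda t}}{4c}\left[\lambda p\,I_0\!\left(\frac{\lambda p}{c}\sqrt{c^2t^2-\eta^2}\right)+\frac{\partial}{\partial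 t}I_0\!\left(\frac{\lambda p}{c}\sqrt{c^2t^2-\eta^2}\right)\right],\qquad |\eta|<ct,$$ that is, the derivative exists, $g(\cdot,t)$ is nonnegative and integrable on $(-ct,ct)$, and for every Borel set $B\subseteq(-ct,ct)$ $$\mathbb{P}\big(X(t)+Y(t)=ct,\ X(t)-Y(t)\in B\big)=\int_B g(\eta,t)\,d\eta .$$ -/

import Mathlib

open MeasureTheory ProbabilityTheory

noncomputable section

/-- The modified Bessel function of the first kind of order zero,
`I₀(x) = ∑ (x/2)^(2k) / (k!)²`. -/
def besselI0 (x : ℝ) : ℝ :=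
  ∑' k : ℕ, (x / 2) ^ (2 * k) / (k.factorial : ℝ) ^ 2

/-- First component of the direction `d_j = (cos (π j / 2), sin (π j / 2))`. -/
def dirX (j : Fin 4) : ℝ := Real.cos (Real.pi * (j : ℕ) / 2)

/-- Second component of the direction `d_j = (cos (π j / 2), sin (π j / 2))`. -/
def dirY (j : Fin 4) : ℝ := Real.sin (Real.pi * (j : ℕ) / 2)

/-- The probability that a switch takes the direction `d_i` to the direction `d_j` (indices are
mod 4). A horizontal direction (`i = 0, 2`) turns counterclockwise with probability `p` and
clockwise with probability `1 - p`; a vertical one (`i = 1, 3`) turns counterclockwise with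
probability `1 - p` and clockwise with probability `p`. -/
def turnProb (p : ℝ) (i j : Fin 4) : ℝ :=
  if j = i + 1 then (if i = 0 ∨ i = 2 then p else 1 - p)
  else if j = i - 1 then (if i = 0 ∨ i = 2 then 1 - p else p)
  else 0

variable {Ω : Type*}

/-- The time of the `n`-th switch, when the successive waiting times are `τ 0, τ 1, …`
(`switchTime τ 0 = 0` is the start of the motion). -/
def switchTime (τ : ℕ → Ω → ℝ) (n : ℕ) (ω : Ω) : ℝ :=
  ∑ k ∈ Finset.range n, τ k ω

/-- `N(t)`: the number of switches that occurred until time `t`. -/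
def switchCount (τ : ℕ → Ω → ℝ) (t : ℝ) (ω : Ω) : ℕ :=
  Set.ncard {n : ℕ | switchTime τ (n + 1) ω ≤ t}

/-- `D(t)`: the index of the direction at time `t`, where `ξ n` is the index of the direction
taken after `n` switches. -/
def direction (τ : ℕ → Ω → ℝ) (ξ : ℕ → Ω → Fin 4) (t : ℝ) (ω : Ω) : Fin 4 :=
  ξ (switchCount τ t ω) ω

/-- `X(t)`: the abscissa at time `t` of the particle that starts at the origin and moves with
speed `c` in the direction `D`. -/
def posX (c : ℝ) (τ : ℕ → Ω → ℝ) (ξ : ℕ → Ω → Fin 4) (t : ℝ) (ω : Ω) : ℝ :=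
  ∫ s in (0 : ℝ)..t, c * dirX (direction τ ξ s ω)

/-- `Y(t)`: the ordinate at time `t` of the same particle. -/
def posY (c : ℝ) (τ : ℕ → Ω → ℝ) (ξ : ℕ → Ω → Fin 4) (t : ℝ) (ω : Ω) : ℝ :=
  ∫ s in (0 : ℝ)..t, c * dirY (direction τ ξ s ω)

/-- The law of the random mechanism: the switches occur at the times of a homogeneous Poisson
process of intensity `lam` (the waiting times `τ n` are independent and exponential with
parameter `lam`); the successive directions `ξ 0, ξ 1, …` form a Markov chain whose initial law is
uniform on the four directions and whose transition probabilities are `turnProb p`; the waiting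
times and the chain of directions are independent. -/
structure IsPlanarMotion [MeasurableSpace Ω] (P : Measure Ω) (lam p : ℝ)
    (τ : ℕ → Ω → ℝ) (ξ : ℕ → Ω → Fin 4) : Prop where
  measurable_wait : ∀ n, Measurable (τ n)
  measurable_dir : ∀ n, Measurable (ξ n)
  wait_law : ∀ n, P.map (τ n) = expMeasure lam
  wait_indep : iIndepFun τ P
  dir_law : ∀ (n : ℕ) (a : ℕ → Fin 4),
    P.real {ω | ∀ k ≤ n, ξ k ω = a k} =
      1 / 4 * ∏ k ∈ Finset.range n, turnProb p (a k) (a (k + 1))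
  wait_dir_indep : IndepFun (fun ω n => τ n ω) (fun ω n => ξ n ω) P

/-- The function
`g(η,t) = e^{-λt}/(4c) [λp I₀((λp/c)√(c²t²-η²)) + ∂/∂t I₀((λp/c)√(c²t²-η²))]`. -/
def boundaryDensity (c lam p η t : ℝ) : ℝ :=
  Real.exp (-lam * t) / (4 * c) *
    (lam * p * besselI0 (lam * p / c * √(c ^ 2 * t ^ 2 - η ^ 2)) +
      deriv (fun s : ℝ => besselI0 (lam * p / c * √(c ^ 2 * s ^ 2 - η ^ 2))) t)

end

/-! Each direction contributes at most its duration times `c` to `X + Y`, with equality only for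
`d₀` and `d₁`; hence `X(t) + Y(t) = c t` holds exactly when the directions alternate between these
two, and every such turn has probability `p`. On this event `X(t) - Y(t)` is, up to sign,
`c (t - 2 U)`, where `U` is the time spent in the direction other than the last one. When there are
`n + 1` switches, `U` and the rest of the completed sojourns are independent Erlang times, so `U`
has on that event the density `λ e^(-λt) (λu)^i / i! (λ(t-u))^j / j!` with `i = ⌊n/2⌋` and
`j = ⌊(n+1)/2⌋`. In the sum over `n`, the even terms give the power series of `I₀` and the odd ones
that of its derivative. -/

/-- The Bessel–Clifford function `∑ zᵏ / (k! (k + m)!)` of order `m`. It satisfies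
`I₀(x) = besselClifford 0 (x² / 4)`, and its derivative is the one of order `m + 1`. -/
noncomputable def besselClifford (m : ℕ) (z : ℝ) : ℝ :=
  ∑' k : ℕ, z ^ k / (k.factorial * (k + m).factorial)

theorem besselI0_eq_besselClifford (x : ℝ) : besselI0 x = besselClifford 0 ((x / 2) ^ 2) := by
  simp only [besselI0, besselClifford, pow_mul, add_zero, sq]

theorem summable_besselClifford (m : ℕ) (z : ℝ) :
    Summable fun k : ℕ => z ^ k / (k.factorial * (k + m).factorial : ℝ) := by
  refine .of_norm_bounded (Real.summable_pow_div_factorial |z|) fun k => ?_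
  have one_le_factorial : (1 : ℝ) ≤ (k + m).factorial := by exact_mod_cast (k + m).factorial_pos
  rw [norm_div, norm_pow, norm_mul, Real.norm_eq_abs, Real.norm_natCast, Real.norm_natCast]
  gcongr
  exact le_mul_of_one_le_right (by positivity) one_le_factorial

theorem hasDerivAt_besselClifford (m : ℕ) (z : ℝ) :
    HasDerivAt (besselClifford m) (besselClifford (m + 1) z) z := by
  have factorial_shift (k : ℕ) : (k + 1 + m).factorial = (k + (m + 1)).factorial := by
    rw [add_right_comm, add_assoc]
  have hasDerivAt_term (k : ℕ) (y : ℝ) :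
      HasDerivAt (fun y : ℝ => y ^ (k + 1) / ((k + 1).factorial * (k + 1 + m).factorial))
        (y ^ k / (k.factorial * (k + (m + 1)).factorial)) y := by
    refine ((hasDerivAt_pow (k + 1) y).div_const _).congr_deriv ?_
    rw [factorial_shift, Nat.factorial_succ k]
    push_cast
    field_simp
  have hasDerivAt_tail := hasDerivAt_tsum_of_isPreconnected (y₀ := z) (y := z)
    (summable_besselClifford (m + 1) (|z| + 1)) Metric.isOpen_ball
    (convex_ball (0 : ℝ) (|z| + 1)).isPreconnected (fun k y _ => hasDerivAt_term k y)
    (fun k y hy => by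
      rw [mem_ball_zero_iff, Real.norm_eq_abs] at hy
      rw [norm_div, norm_pow, norm_mul, Real.norm_eq_abs, Real.norm_natCast, Real.norm_natCast]
      gcongr)
    (by simp) ((summable_nat_add_iff 1).2 (summable_besselClifford m z)) (by simp)
  refine (hasDerivAt_tail.const_add (1 / m.factorial : ℝ)).congr_of_eventuallyEq ?_
  refine .of_forall fun y => ?_
  rw [besselClifford, (summable_besselClifford m y).tsum_eq_zero_add]
  simp

theorem continuous_besselClifford (m : ℕ) : Continuous (besselClifford m) :=
  continuous_iff_continuousAt.2 fun z => (hasDerivAt_besselClifford m z).continuousAt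

theorem hasDerivAt_besselI0_mul_sqrt {f : ℝ → ℝ} {f' t : ℝ} (κ : ℝ) (hf : HasDerivAt f f' t)
    (hpos : 0 < f t) :
    HasDerivAt (fun s => besselI0 (κ * √(f s)))
      (besselClifford 1 (κ ^ 2 / 4 * f t) * (κ ^ 2 / 4 * f')) t := by
  have hasDerivAt_comp := (hasDerivAt_besselClifford 0 _).comp t (hf.const_mul (κ ^ 2 / 4))
  refine hasDerivAt_comp.congr_of_eventuallyEq ?_
  filter_upwards [hf.continuousAt.eventually (lt_mem_nhds hpos)] with s hs
  rw [besselI0_eq_besselClifford, Function.comp, div_pow, mul_pow, Real.sq_sqrt hs.le]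
  congr 1
  ring

theorem lightCone_pos {c t η : ℝ} (hη : η ∈ Set.Ioo (-(c * t)) (c * t)) :
    0 < c ^ 2 * t ^ 2 - η ^ 2 := by
  rw [← mul_pow]
  exact sub_pos.2 (sq_lt_sq' hη.1 hη.2)

theorem hasDerivAt_besselI0_lightCone {c t η : ℝ} (κ : ℝ)
    (hη : η ∈ Set.Ioo (-(c * t)) (c * t)) :
    HasDerivAt (fun s : ℝ => besselI0 (κ * √(c ^ 2 * s ^ 2 - η ^ 2)))
      (besselClifford 1 (κ ^ 2 / 4 * (c ^ 2 * t ^ 2 - η ^ 2)) * (κ ^ 2 / 4 * (c ^ 2 * (2 * t))))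
      t := by
  refine hasDerivAt_besselI0_mul_sqrt (f := fun s => c ^ 2 * s ^ 2 - η ^ 2) κ ?_ (lightCone_pos hη)
  simpa using ((hasDerivAt_pow 2 t).const_mul (c ^ 2)).sub_const (η ^ 2)

theorem boundaryDensity_eq {c t η : ℝ} (lam p : ℝ) (hc : 0 < c)
    (hη : η ∈ Set.Ioo (-(c * t)) (c * t)) :
    boundaryDensity c lam p η t = Real.exp (-(lam * t)) / (4 * c) *
      (lam * p * besselClifford 0 ((lam * p) ^ 2 * ((t - η / c) / 2 * ((t + η / c) / 2))) +
        (lam * p) ^ 2 * (t / 2) *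
          besselClifford 1 ((lam * p) ^ 2 * ((t - η / c) / 2 * ((t + η / c) / 2)))) := by
  have arg_eq : (lam * p / c) ^ 2 / 4 * (c ^ 2 * t ^ 2 - η ^ 2) =
      (lam * p) ^ 2 * ((t - η / c) / 2 * ((t + η / c) / 2)) := by
    field_simp
    ring
  have sq_arg : (lam * p / c * √(c ^ 2 * t ^ 2 - η ^ 2) / 2) ^ 2 =
      (lam * p / c) ^ 2 / 4 * (c ^ 2 * t ^ 2 - η ^ 2) := by
    rw [div_pow, mul_pow, Real.sq_sqrt (lightCone_pos hη).le]
    ring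
  rw [boundaryDensity, (hasDerivAt_besselI0_lightCone _ hη).deriv, besselI0_eq_besselClifford,
    sq_arg, arg_eq, neg_mul]
  field_simp
  ring

theorem integrableOn_boundaryDensity {c : ℝ} (lam p t : ℝ) (hc : 0 < c) :
    IntegrableOn (fun η => boundaryDensity c lam p η t) (Set.Ioo (-(c * t)) (c * t)) := by
  refine IntegrableOn.congr_fun (Continuous.integrableOn_Icc ?_ |>.mono_set Set.Ioo_subset_Icc_self)
    (fun η hη => (boundaryDensity_eq lam p hc hη).symm) measurableSet_Ioo
  have := continuous_besselClifford
  fun_prop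

/-- The weight `e⁻ᵃ aⁿ / n!` that the Poisson law of mean `a` gives to `n`. It is defined for every
real `a`, so that no sign condition enters the power series identities below. -/
noncomputable def poissonWeight (n : ℕ) (a : ℝ) : ℝ :=
  Real.exp (-a) * (a ^ n / n.factorial)

theorem poissonWeight_nonneg (n : ℕ) {a : ℝ} (ha : 0 ≤ a) : 0 ≤ poissonWeight n a := by
  unfold poissonWeight
  positivity

theorem hasSum_poissonWeight (a : ℝ) : HasSum (fun n => poissonWeight n a) 1 := by
  have hasSum_exp : HasSum (fun n : ℕ => a ^ n / n.factorial) (Real.exp a) := by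
    rw [Real.exp_eq_exp_ℝ]
    exact NormedSpace.expSeries_div_hasSum_exp a
  simpa [poissonWeight, Real.exp_neg] using hasSum_exp.mul_left (Real.exp (-a))

/-- For a Poisson process of intensity `lam` whose `n + 1` events before time `u + v` cut
`[0, u + v]` into intervals alternating between two states, the density with which the state that
is not the final one is occupied for the time `u`, and hence the final one for the time `v`. -/
noncomputable def occupationDensity (lam : ℝ) (n : ℕ) (u v : ℝ) : ℝ :=
  lam * poissonWeight (n / 2) (lam * u) * poissonWeight ((n + 1) / 2) (lam * v)

theorem occupationDensity_nonneg {lam u v : ℝ} (n : ℕ) (hlam : 0 ≤ lam) (hu : 0 ≤ u)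
    (hv : 0 ≤ v) : 0 ≤ occupationDensity lam n u v :=
  mul_nonneg (mul_nonneg hlam (poissonWeight_nonneg _ (mul_nonneg hlam hu)))
    (poissonWeight_nonneg _ (mul_nonneg hlam hv))

theorem hasSum_pow_mul_occupationDensity (lam p u v : ℝ) :
    HasSum (fun n => p ^ (n + 1) * occupationDensity lam n u v)
      (Real.exp (-(lam * (u + v))) * (lam * p * besselClifford 0 ((lam * p) ^ 2 * (u * v)) +
        (lam * p) ^ 2 * v * besselClifford 1 ((lam * p) ^ 2 * (u * v)))) := by
  have exp_add : Real.exp (-(lam * (u + v))) = Real.exp (-(lam * u)) * Real.exp (-(lam * v)) := by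
    rw [← Real.exp_add]
    ring_nf
  have hasSum_clifford (m : ℕ) := (summable_besselClifford m ((lam * p) ^ 2 * (u * v))).hasSum
  rw [mul_add, ← mul_assoc _ (lam * p), ← mul_assoc _ ((lam * p) ^ 2 * v), exp_add]
  refine HasSum.even_add_odd (((hasSum_clifford 0).mul_left _).congr_fun fun k => ?_)
    (((hasSum_clifford 1).mul_left _).congr_fun fun k => ?_)
  · rw [occupationDensity, poissonWeight, poissonWeight, show 2 * k / 2 = k by omega,
      show (2 * k + 1) / 2 = k by omega, add_zero]
    field_simp
    ring
  · rw [occupationDensity, poissonWeight, poissonWeight, show (2 * k + 1) / 2 = k by omega,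
      show (2 * k + 1 + 1) / 2 = k + 1 by omega]
    field_simp
    ring

section Erlang

variable {lam : ℝ}

/-- The law of the sum of `m` independent exponential variables of parameter `lam`. -/
noncomputable def erlangMeasure (lam : ℝ) : ℕ → Measure ℝ
  | 0 => Measure.dirac 0
  | k + 1 => gammaMeasure (k + 1) lam

theorem isProbabilityMeasure_erlangMeasure (hlam : 0 < lam) (m : ℕ) :
    IsProbabilityMeasure (erlangMeasure lam m) := by
  cases m with
  | zero => exact Measure.dirac.isProbabilityMeasure
  | succ k => exact isProbabilityMeasure_gammaMeasure (by positivity) hlam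

theorem gammaPDF_natCast_add_one {x : ℝ} (hlam : 0 ≤ lam) (k : ℕ) (hx : 0 ≤ x) :
    gammaPDF (k + 1) lam x = ENNReal.ofReal (lam * poissonWeight k (lam * x)) := by
  rw [gammaPDF_of_nonneg hx, Real.Gamma_nat_eq_factorial, add_sub_cancel_right,
    Real.rpow_natCast, Real.rpow_add_one' hlam (by positivity), Real.rpow_natCast, poissonWeight]
  congr 1
  ring

theorem conv_withDensity {G : Type*} [AddGroup G] [MeasurableSpace G] [MeasurableAdd₂ G]
    [MeasurableNeg G] (μ ν : Measure G) [SFinite μ] [SFinite ν] [ν.IsAddLeftInvariant]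
    {g : G → ENNReal} (hg : Measurable g) :
    μ ∗ ν.withDensity g = ν.withDensity fun y => ∫⁻ x, g (-x + y) ∂μ := by
  refine Measure.ext_of_lintegral _ fun f hf => ?_
  rw [Measure.lintegral_conv hf, lintegral_withDensity_eq_lintegral_mul _ (by fun_prop) hf]
  calc ∫⁻ x, ∫⁻ y, f (x + y) ∂ν.withDensity g ∂μ
      = ∫⁻ x, ∫⁻ y, g (-x + y) * f y ∂ν ∂μ := by
        refine lintegral_congr fun x => ?_
        rw [lintegral_withDensity_eq_lintegral_mul _ hg (by fun_prop),
          ← lintegral_add_left_eq_self (fun y => g (-x + y) * f y) x]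
        simp
    _ = ∫⁻ y, ∫⁻ x, g (-x + y) * f y ∂μ ∂ν := lintegral_lintegral_swap (by fun_prop)
    _ = _ := lintegral_congr fun y => by
        rw [lintegral_mul_const _ (by fun_prop), Pi.mul_apply]

theorem setLIntegral_Icc_pow_div_factorial {x : ℝ} (hx : 0 ≤ x) (k : ℕ) :
    ∫⁻ y in Set.Icc 0 x, ENNReal.ofReal (y ^ k / k.factorial) =
      ENNReal.ofReal (x ^ (k + 1) / (k + 1).factorial) := by
  have hcont : Continuous fun y : ℝ => y ^ k / (k.factorial : ℝ) := by fun_prop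
  rw [← ofReal_integral_eq_lintegral_ofReal hcont.integrableOn_Icc]
  · rw [integral_Icc_eq_integral_Ioc, ← intervalIntegral.integral_of_le hx,
      intervalIntegral.integral_div, integral_pow, Nat.factorial_succ]
    push_cast
    field_simp
    simp
  · filter_upwards [ae_restrict_mem measurableSet_Icc] with y hy
    exact div_nonneg (pow_nonneg hy.1 k) (Nat.cast_nonneg _)

theorem measurable_gammaPDF (a r : ℝ) : Measurable (gammaPDF a r) :=
  (measurable_gammaPDFReal a r).ennreal_ofReal

theorem measurable_exponentialPDF_sub (lam w : ℝ) :
    Measurable fun x => exponentialPDF lam (w - x) :=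
  (measurable_gammaPDF 1 lam).comp (measurable_const.sub measurable_id)

theorem gammaPDF_mul_exponentialPDF_sub (hlam : 0 < lam) (k : ℕ) (w x : ℝ) :
    gammaPDF (k + 1) lam x * exponentialPDF lam (w - x) =
      (Set.Icc 0 w).indicator (fun x => ENNReal.ofReal (lam ^ (k + 2) * Real.exp (-(lam * w))) *
        ENNReal.ofReal (x ^ k / k.factorial)) x := by
  by_cases hx : x ∈ Set.Icc 0 w
  · have exp_split : Real.exp (-(lam * w)) =
        Real.exp (-(lam * x)) * Real.exp (-(lam * (w - x))) := by
      rw [← Real.exp_add]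
      ring_nf
    have : 0 ≤ x ^ k := pow_nonneg hx.1 k
    rw [Set.indicator_of_mem hx, gammaPDF_natCast_add_one hlam.le k hx.1,
      exponentialPDF_of_nonneg (sub_nonneg.2 hx.2), ← ENNReal.ofReal_mul' (by positivity),
      ← ENNReal.ofReal_mul (by positivity), exp_split, poissonWeight]
    ring_nf
  · rw [Set.indicator_of_notMem hx]
    rcases not_and_or.1 hx with h | h
    · rw [gammaPDF_of_neg (not_le.1 h), zero_mul]
    · rw [exponentialPDF_of_neg (sub_neg.2 (not_le.1 h)), mul_zero]

theorem lintegral_exponentialPDF_sub_erlangMeasure (hlam : 0 < lam) (m : ℕ) (w : ℝ) :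
    ∫⁻ x, exponentialPDF lam (w - x) ∂erlangMeasure lam m = gammaPDF (m + 1) lam w := by
  cases m with
  | zero => simp [erlangMeasure, exponentialPDF, gammaPDF, exponentialPDFReal]
  | succ k =>
    rw [erlangMeasure, gammaMeasure, lintegral_withDensity_eq_lintegral_mul _
      (measurable_gammaPDF _ _) (measurable_exponentialPDF_sub _ _)]
    simp_rw [Pi.mul_apply, gammaPDF_mul_exponentialPDF_sub hlam]
    rw [lintegral_indicator measurableSet_Icc, lintegral_const_mul _ (by fun_prop)]
    rcases le_or_gt 0 w with hw | hw
    · rw [setLIntegral_Icc_pow_div_factorial hw, ← ENNReal.ofReal_mul (by positivity),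
        gammaPDF_natCast_add_one hlam.le _ hw, poissonWeight]
      ring_nf
    · simp [Set.Icc_eq_empty hw.not_ge, gammaPDF_of_neg hw]

theorem erlangMeasure_conv_expMeasure (hlam : 0 < lam) (m : ℕ) :
    erlangMeasure lam m ∗ expMeasure lam = erlangMeasure lam (m + 1) := by
  have := isProbabilityMeasure_erlangMeasure hlam m
  refine (conv_withDensity _ _ (measurable_gammaPDF 1 lam)).trans ?_
  simp_rw [neg_add_eq_sub]
  congr 1
  ext w
  exact_mod_cast lintegral_exponentialPDF_sub_erlangMeasure hlam m w

theorem expMeasure_Iic (hlam : 0 < lam) {a : ℝ} (ha : 0 ≤ a) :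
    expMeasure lam (Set.Iic a) = ENNReal.ofReal (1 - Real.exp (-(lam * a))) := by
  have := isProbabilityMeasure_expMeasure hlam
  rw [← ofReal_cdf, cdf_expMeasure_eq hlam, if_pos ha]

theorem ae_pos_expMeasure (hlam : 0 < lam) : ∀ᵐ x ∂expMeasure lam, 0 < x := by
  simp_rw [ae_iff, not_lt]
  exact (expMeasure_Iic hlam le_rfl).trans (by simp)

theorem expMeasure_Ioi (hlam : 0 < lam) {a : ℝ} (ha : 0 ≤ a) :
    expMeasure lam (Set.Ioi a) = (ENNReal.ofReal lam)⁻¹ * exponentialPDF lam a := by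
  have := isProbabilityMeasure_expMeasure hlam
  have exp_le_one : Real.exp (-(lam * a)) ≤ 1 :=
    Real.exp_le_one_iff.2 (neg_nonpos.2 (by positivity))
  rw [← Set.compl_Iic, prob_compl_eq_one_sub measurableSet_Iic, expMeasure_Iic hlam ha,
    ← ENNReal.ofReal_one, ← ENNReal.ofReal_sub _ (sub_nonneg.2 exp_le_one), sub_sub_cancel,
    exponentialPDF_of_nonneg ha, ← ENNReal.ofReal_inv_of_pos hlam,
    ← ENNReal.ofReal_mul (by positivity), inv_mul_cancel_left₀ hlam.ne']

theorem erlangMeasure_prod_expMeasure_le_lt (hlam : 0 < lam) (m : ℕ) (w : ℝ) :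
    ((erlangMeasure lam m).prod (expMeasure lam)) {q | q.1 ≤ w ∧ w < q.1 + q.2} =
      (ENNReal.ofReal lam)⁻¹ * gammaPDF (m + 1) lam w := by
  have := isProbabilityMeasure_expMeasure hlam
  have section_eq (x : ℝ) :
      expMeasure lam (Prod.mk x ⁻¹' {q : ℝ × ℝ | q.1 ≤ w ∧ w < q.1 + q.2}) =
        (ENNReal.ofReal lam)⁻¹ * exponentialPDF lam (w - x) := by
    rcases le_or_gt x w with hx | hx
    · rw [← expMeasure_Ioi hlam (sub_nonneg.2 hx)]
      congr 1 with y
      simp [hx, sub_lt_iff_lt_add']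
    · simp [exponentialPDF_of_neg (sub_neg.2 hx), hx.not_ge]
  rw [Measure.prod_apply (by measurability)]
  simp_rw [section_eq]
  rw [lintegral_const_mul _ (measurable_exponentialPDF_sub _ _),
    lintegral_exponentialPDF_sub_erlangMeasure hlam]

theorem setLIntegral_gammaPDF_sub_erlangMeasure (hlam : 0 < lam) (k m : ℕ) {t : ℝ} {A : Set ℝ}
    (hA : MeasurableSet A) (hAt : A ⊆ Set.Icc 0 t) :
    ∫⁻ u in A, (ENNReal.ofReal lam)⁻¹ * gammaPDF (m + 1) lam (t - u) ∂erlangMeasure lam (k + 1) =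
      ∫⁻ u in A, ENNReal.ofReal
        (lam * poissonWeight k (lam * u) * poissonWeight m (lam * (t - u))) := by
  have measurable_sub : Measurable fun u => (ENNReal.ofReal lam)⁻¹ * gammaPDF (m + 1) lam (t - u) :=
    ((measurable_gammaPDF _ _).comp (measurable_const.sub measurable_id)).const_mul _
  rw [erlangMeasure, gammaMeasure, setLIntegral_withDensity_eq_setLIntegral_mul _
    (measurable_gammaPDF _ _) measurable_sub hA]
  refine setLIntegral_congr_fun hA fun u hu => ?_
  have weight_nonneg := poissonWeight_nonneg k (mul_nonneg hlam.le (hAt hu).1)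
  rw [Pi.mul_apply, gammaPDF_natCast_add_one hlam.le k (hAt hu).1,
    gammaPDF_natCast_add_one hlam.le m (sub_nonneg.2 (hAt hu).2),
    ← ENNReal.ofReal_inv_of_pos hlam, ← ENNReal.ofReal_mul (inv_nonneg.2 hlam.le),
    inv_mul_cancel_left₀ hlam.ne', ENNReal.ofReal_mul (mul_nonneg hlam.le weight_nonneg)]

end Erlang

section Independence

variable {ι Ω : Type*} [MeasurableSpace Ω] {P : Measure Ω} {lam : ℝ} {τ : ι → Ω → ℝ}

theorem measurable_finsetSum (hmeas : ∀ i, Measurable (τ i)) (S : Finset ι) :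
    Measurable (∑ i ∈ S, τ i) := by
  simp_rw [Finset.sum_fn]
  exact Finset.measurable_sum S fun i _ => hmeas i

theorem map_sum_eq_erlangMeasure [IsProbabilityMeasure P] (hlam : 0 < lam)
    (hmeas : ∀ i, Measurable (τ i)) (hlaw : ∀ i, P.map (τ i) = expMeasure lam)
    (hindep : iIndepFun τ P) (S : Finset ι) :
    P.map (∑ i ∈ S, τ i) = erlangMeasure lam S.card := by
  classical
  induction S using Finset.induction_on with
  | empty =>
    rw [Finset.sum_empty, Finset.card_empty, erlangMeasure]
    exact (Measure.map_const P 0).trans (by simp)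
  | insert i S hi ih =>
    rw [Finset.sum_insert hi, add_comm,
      (hindep.indepFun_finsetSum_of_notMem hmeas hi).map_add_eq_map_conv_map
        (measurable_finsetSum hmeas S) (hmeas i), ih, hlaw,
      Finset.card_insert_of_notMem hi, erlangMeasure_conv_expMeasure hlam]

theorem indepFun_sum_prodMk_sum (hmeas : ∀ i, Measurable (τ i))
    (hindep : iIndepFun τ P) {S T : Finset ι} (hST : Disjoint S T) {m : ι} (hmS : m ∉ S) :
    IndepFun (∑ i ∈ S, τ i) (fun ω => ((∑ i ∈ T, τ i) ω, τ m ω)) P := by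
  classical
  have disjoint_insert : Disjoint S (insert m T) := Finset.disjoint_insert_right.2 ⟨hmS, hST⟩
  convert (hindep.indepFun_finset S (insert m T) disjoint_insert hmeas).comp
    (φ := fun v : S → ℝ => ∑ i : S, v i)
    (ψ := fun v : ↥(insert m T) → ℝ =>
      (∑ i : T, v ⟨i, Finset.mem_insert_of_mem i.2⟩, v ⟨m, Finset.mem_insert_self m T⟩))
    (by fun_prop) (by fun_prop) using 1
  · ext ω
    simpa using (Finset.sum_coe_sort S fun i => τ i ω).symm
  · ext ω
    · simpa using (Finset.sum_coe_sort T fun i => τ i ω).symm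
    · rfl

theorem map_sum_sum_eq_prod [IsProbabilityMeasure P] (hlam : 0 < lam)
    (hmeas : ∀ i, Measurable (τ i)) (hlaw : ∀ i, P.map (τ i) = expMeasure lam)
    (hindep : iIndepFun τ P) {S T : Finset ι} (hST : Disjoint S T) {m : ι} (hmS : m ∉ S)
    (hmT : m ∉ T) :
    P.map (fun ω => ((∑ i ∈ S, τ i) ω, (∑ i ∈ T, τ i) ω, τ m ω)) =
      (erlangMeasure lam S.card).prod ((erlangMeasure lam T.card).prod (expMeasure lam)) := by
  rw [(indepFun_iff_map_prod_eq_prod_map_map (measurable_finsetSum hmeas S).aemeasurable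
      ((measurable_finsetSum hmeas T).prodMk (hmeas m)).aemeasurable).1
      (indepFun_sum_prodMk_sum hmeas hindep hST hmS),
    (indepFun_iff_map_prod_eq_prod_map_map (measurable_finsetSum hmeas T).aemeasurable
      (hmeas m).aemeasurable).1 (hindep.indepFun_finsetSum_of_notMem hmeas hmT),
    map_sum_eq_erlangMeasure hlam hmeas hlaw hindep,
    map_sum_eq_erlangMeasure hlam hmeas hlaw hindep, hlaw]

theorem measure_sum_mem_and_sum_le_lt [IsProbabilityMeasure P] (hlam : 0 < lam)
    (hmeas : ∀ i, Measurable (τ i)) (hlaw : ∀ i, P.map (τ i) = expMeasure lam)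
    (hindep : iIndepFun τ P) {S T : Finset ι} (hST : Disjoint S T) {m : ι} (hmS : m ∉ S)
    (hmT : m ∉ T) (t : ℝ) {A : Set ℝ} (hA : MeasurableSet A) :
    P {ω | ∑ i ∈ S, τ i ω ∈ A ∧ ∑ i ∈ S, τ i ω + ∑ i ∈ T, τ i ω ≤ t ∧
        t < ∑ i ∈ S, τ i ω + ∑ i ∈ T, τ i ω + τ m ω} =
      ∫⁻ u in A, (ENNReal.ofReal lam)⁻¹ * gammaPDF (T.card + 1) lam (t - u)
        ∂erlangMeasure lam S.card := by
  have := isProbabilityMeasure_expMeasure hlam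
  have := isProbabilityMeasure_erlangMeasure hlam T.card
  let E : Set (ℝ × ℝ × ℝ) := {q | q.1 ∈ A ∧ q.1 + q.2.1 ≤ t ∧ t < q.1 + q.2.1 + q.2.2}
  have measurableSet_E : MeasurableSet E :=
    (measurable_fst hA).inter <|
      (measurableSet_le (measurable_fst.add measurable_snd.fst) measurable_const).inter
        (measurableSet_lt measurable_const
          ((measurable_fst.add measurable_snd.fst).add measurable_snd.snd))
  have section_eq (u : ℝ) : (erlangMeasure lam T.card).prod (expMeasure lam) (Prod.mk u ⁻¹' E) =
      A.indicator (fun u => (ENNReal.ofReal lam)⁻¹ * gammaPDF (T.card + 1) lam (t - u)) u := by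
    by_cases hu : u ∈ A
    · rw [Set.indicator_of_mem hu, ← erlangMeasure_prod_expMeasure_le_lt hlam]
      congr 1 with q
      simp [E, hu, add_assoc, le_sub_iff_add_le', sub_lt_iff_lt_add']
    · simp [E, hu]
  calc _ = P.map (fun ω => ((∑ i ∈ S, τ i) ω, (∑ i ∈ T, τ i) ω, τ m ω)) E := by
        rw [Measure.map_apply ((measurable_finsetSum hmeas S).prodMk
          ((measurable_finsetSum hmeas T).prodMk (hmeas m))) measurableSet_E]
        simp [E]
    _ = _ := by
        rw [map_sum_sum_eq_prod hlam hmeas hlaw hindep hST hmS hmT,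
          Measure.prod_apply measurableSet_E, ← lintegral_indicator hA]
        simp_rw [section_eq]

end Independence

section Directions

theorem dirX_eq : dirX = ![1, 0, -1, 0] := by
  ext j
  fin_cases j
  · simp [dirX]
  · simp [dirX]
  · simp [dirX]
  · simp [dirX, show Real.pi * 3 / 2 = Real.pi + Real.pi / 2 by ring, Real.cos_add]

theorem dirY_eq : dirY = ![0, 1, 0, -1] := by
  ext j
  fin_cases j
  · simp [dirY]
  · simp [dirY]
  · simp [dirY]
  · simp [dirY, show Real.pi * 3 / 2 = Real.pi + Real.pi / 2 by ring, Real.sin_add]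

theorem dirX_add_dirY_le_one (i : Fin 4) : dirX i + dirY i ≤ 1 := by
  fin_cases i <;> norm_num [dirX_eq, dirY_eq]

theorem dirX_add_dirY_eq_one_iff (i : Fin 4) : dirX i + dirY i = 1 ↔ i = 0 ∨ i = 1 := by
  fin_cases i <;> norm_num [dirX_eq, dirY_eq]

/-- The sequence of directions `d₀, d₁, d₀, d₁, …`. -/
def alternatingDir (m : ℕ) : Fin 4 := if Even m then 0 else 1

theorem alternatingDir_eq_zero_or_one (m : ℕ) : alternatingDir m = 0 ∨ alternatingDir m = 1 :=
  ite_eq_or_eq _ _ _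

theorem eq_alternatingDir_succ {i : Fin 4} {m : ℕ} (hi : i = 0 ∨ i = 1)
    (hne : alternatingDir m ≠ i) : i = alternatingDir (m + 1) := by
  unfold alternatingDir at *
  grind

theorem dirX_sub_dirY_alternatingDir (m : ℕ) :
    dirX (alternatingDir m) - dirY (alternatingDir m) = (-1) ^ m := by
  rcases Nat.even_or_odd m with h | h
  · simp [alternatingDir, h, h.neg_one_pow, dirX_eq, dirY_eq]
  · simp [alternatingDir, Nat.not_even_iff_odd.2 h, h.neg_one_pow, dirX_eq, dirY_eq]

theorem turnProb_alternatingDir (p : ℝ) (m : ℕ) :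
    turnProb p (alternatingDir m) (alternatingDir (m + 1)) = p := by
  rcases Nat.even_or_odd m with h | h
  · simp [alternatingDir, turnProb, h, Nat.even_add_one]
  · simp [alternatingDir, turnProb, Nat.not_even_iff_odd.2 h, Nat.even_add_one]

theorem turnProb_self (p : ℝ) (i : Fin 4) : turnProb p i i = 0 := by
  fin_cases i <;> simp [turnProb]

theorem exists_eq_alternatingDir {x : ℕ → Fin 4} {n : ℕ} (h01 : ∀ k ≤ n, x k = 0 ∨ x k = 1)
    (hne : ∀ k, x k ≠ x (k + 1)) : ∃ e : Fin 2, ∀ k ≤ n, x k = alternatingDir (n + k + e) := by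
  have alternating_of_zero {e : ℕ} (h0 : x 0 = alternatingDir (n + 0 + e)) (k : ℕ) (hk : k ≤ n) :
      x k = alternatingDir (n + k + e) := by
    induction k with
    | zero => exact h0
    | succ k ih =>
      rw [show n + (k + 1) + e = n + k + e + 1 by ring]
      exact eq_alternatingDir_succ (h01 (k + 1) hk) (ih (by omega) ▸ hne k)
  by_cases h0 : x 0 = alternatingDir n
  · exact ⟨0, alternating_of_zero h0⟩
  · exact ⟨1, alternating_of_zero (eq_alternatingDir_succ (h01 0 n.zero_le) (Ne.symm h0))⟩

/-- The indices `i < n` with `n - i` odd: the sojourns before the `n`-th switch during which a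
particle alternating between two directions has the direction that it leaves at that switch. -/
def oddGap (n : ℕ) : Finset ℕ := {i ∈ Finset.range n | Odd (n + i)}

/-- The indices `i < n` with `n - i` even: the sojourns before the `n`-th switch during which a
particle alternating between two directions has the direction that it takes at that switch. -/
def evenGap (n : ℕ) : Finset ℕ := {i ∈ Finset.range n | ¬ Odd (n + i)}

theorem oddGap_succ (n : ℕ) : oddGap (n + 1) = insert n (evenGap n) := by
  ext i
  simp only [oddGap, evenGap, Finset.mem_filter, Finset.mem_range, Finset.mem_insert]
  grind

theorem evenGap_succ (n : ℕ) : evenGap (n + 1) = oddGap n := by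
  ext i
  simp only [oddGap, evenGap, Finset.mem_filter, Finset.mem_range]
  grind

theorem self_notMem_oddGap (n : ℕ) : n ∉ oddGap n := by simp [oddGap]

theorem self_notMem_evenGap (n : ℕ) : n ∉ evenGap n := by simp [evenGap]

theorem disjoint_oddGap_evenGap (n : ℕ) : Disjoint (oddGap n) (evenGap n) :=
  Finset.disjoint_filter_filter_not _ _ _

theorem sum_oddGap_add_sum_evenGap (v : ℕ → ℝ) (n : ℕ) :
    ∑ i ∈ oddGap n, v i + ∑ i ∈ evenGap n, v i = ∑ i ∈ Finset.range n, v i :=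
  Finset.sum_filter_add_sum_filter_not _ _ _

theorem card_oddGap_and_card_evenGap (n : ℕ) :
    (oddGap n).card = (n + 1) / 2 ∧ (evenGap n).card = n / 2 := by
  induction n with
  | zero => simp [oddGap, evenGap]
  | succ n ih =>
    rw [oddGap_succ, evenGap_succ, Finset.card_insert_of_notMem (self_notMem_evenGap n), ih.1, ih.2]
    omega

theorem sum_mul_neg_one_pow (v : ℕ → ℝ) (n : ℕ) :
    ∑ k ∈ Finset.range (n + 1), v k * (-1) ^ (n + k) =
      ∑ k ∈ Finset.range (n + 1), v k - 2 * ∑ k ∈ oddGap n, v k := by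
  have neg_one_pow_eq (m : ℕ) : (-1 : ℝ) ^ m = 1 - if Odd m then 2 else 0 := by
    rcases Nat.even_or_odd m with h | h
    · simp [h.neg_one_pow, Nat.not_odd_iff_even.2 h]
    · norm_num [h.neg_one_pow, h]
  have sum_odd : ∑ k ∈ Finset.range (n + 1), v k * (if Odd (n + k) then 2 else 0) =
      2 * ∑ k ∈ oddGap n, v k := by
    rw [Finset.sum_range_succ, oddGap, Finset.sum_filter, Finset.mul_sum]
    simp [mul_comm]
  simp_rw [neg_one_pow_eq, mul_sub, mul_one, Finset.sum_sub_distrib, sum_odd]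

end Directions

section Path

variable {Ω : Type*} {τ : ℕ → Ω → ℝ} {ξ : ℕ → Ω → Fin 4} {ω : Ω} {n : ℕ} {t : ℝ}

theorem switchTime_zero : switchTime τ 0 ω = 0 := Finset.sum_range_zero _

theorem switchTime_succ (n : ℕ) : switchTime τ (n + 1) ω = switchTime τ n ω + τ n ω :=
  Finset.sum_range_succ _ _

theorem strictMono_switchTime (hpos : ∀ k, 0 < τ k ω) : StrictMono fun n => switchTime τ n ω :=
  strictMono_nat_of_lt_succ fun n => by
    rw [switchTime_succ]
    exact lt_add_of_pos_right _ (hpos n)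

theorem switchTime_mono (hpos : ∀ k, 0 < τ k ω) {m : ℕ} (h : m ≤ n) :
    switchTime τ m ω ≤ switchTime τ n ω :=
  (strictMono_switchTime hpos).monotone h

theorem switchTime_nonneg (hpos : ∀ k, 0 < τ k ω) (n : ℕ) : 0 ≤ switchTime τ n ω :=
  Finset.sum_nonneg fun k _ => (hpos k).le

theorem switchCount_eq (hpos : ∀ k, 0 < τ k ω) (hle : switchTime τ n ω ≤ t)
    (hlt : t < switchTime τ (n + 1) ω) : switchCount τ t ω = n := by
  have setOf_eq : {m : ℕ | switchTime τ (m + 1) ω ≤ t} = Set.Iio n := by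
    ext m
    refine ⟨fun hm => ?_, fun hm => (switchTime_mono hpos hm).trans hle⟩
    exact Nat.lt_of_succ_lt_succ ((strictMono_switchTime hpos).lt_iff_lt.1 (hm.trans_lt hlt))
  rw [switchCount, setOf_eq, ← Finset.coe_Iio, Set.ncard_coe_finset, Nat.card_Iio]

theorem eqOn_direction (hpos : ∀ k, 0 < τ k ω) (n : ℕ) :
    Set.EqOn (fun s => direction τ ξ s ω) (fun _ => ξ n ω)
      (Set.Ico (switchTime τ n ω) (switchTime τ (n + 1) ω)) := fun s hs => by
  simp only [direction, switchCount_eq hpos hs.1 hs.2]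

/-- The time before `t` that the particle spends in its `k`-th direction. -/
def sojourn (τ : ℕ → Ω → ℝ) (t : ℝ) (k : ℕ) (ω : Ω) : ℝ :=
  min (switchTime τ (k + 1) ω) t - min (switchTime τ k ω) t

theorem sojourn_of_lt (hpos : ∀ k, 0 < τ k ω) (hle : switchTime τ n ω ≤ t) {k : ℕ} (hk : k < n) :
    sojourn τ t k ω = τ k ω := by
  rw [sojourn, min_eq_left ((switchTime_mono hpos hk).trans hle),
    min_eq_left ((switchTime_mono hpos hk.le).trans hle),
    switchTime_succ, add_sub_cancel_left]

theorem sojourn_pos (hpos : ∀ k, 0 < τ k ω) (hlt : switchTime τ n ω < t) {k : ℕ} (hk : k ≤ n) :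
    0 < sojourn τ t k ω := by
  have switchTime_lt : switchTime τ k ω < t := (switchTime_mono hpos hk).trans_lt hlt
  rw [sojourn, min_eq_left switchTime_lt.le, sub_pos]
  exact lt_min ((strictMono_switchTime hpos) k.lt_succ_self) switchTime_lt

theorem sum_sojourn (ht : 0 ≤ t) (hlt : t < switchTime τ (n + 1) ω) :
    ∑ k ∈ Finset.range (n + 1), sojourn τ t k ω = t := by
  simp only [sojourn]
  rw [Finset.sum_range_sub (fun k => min (switchTime τ k ω) t), min_eq_right hlt.le,
    switchTime_zero, min_eq_left ht, sub_zero]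

theorem integral_direction (hpos : ∀ k, 0 < τ k ω) (f : Fin 4 → ℝ)
    (hle : switchTime τ n ω ≤ t) (hlt : t < switchTime τ (n + 1) ω) :
    ∫ s in (0 : ℝ)..t, f (direction τ ξ s ω) =
      ∑ k ∈ Finset.range (n + 1), sojourn τ t k ω * f (ξ k ω) := by
  have ht : 0 ≤ t := (switchTime_nonneg hpos n).trans hle
  have ordered (k : ℕ) : min (switchTime τ k ω) t ≤ min (switchTime τ (k + 1) ω) t :=
    min_le_min_right t (switchTime_mono hpos k.le_succ)
  have eqOn_const (k : ℕ) (hk : k ≤ n) : Set.EqOn (fun _ => f (ξ k ω))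
      (fun s => f (direction τ ξ s ω))
      (Set.Ioo (min (switchTime τ k ω) t) (min (switchTime τ (k + 1) ω) t)) := fun s hs => by
    rw [min_eq_left ((switchTime_mono hpos hk).trans hle)] at hs
    exact congrArg f (eqOn_direction hpos k ⟨hs.1.le, hs.2.trans_le (min_le_left _ _)⟩).symm
  have sum_integral := intervalIntegral.sum_integral_adjacent_intervals
    (a := fun k => min (switchTime τ k ω) t) (n := n + 1) (μ := volume)
    (f := fun s => f (direction τ ξ s ω)) fun k hk => by
      rw [intervalIntegrable_iff_integrableOn_Ioo_of_le (ordered k)]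
      exact (integrableOn_const (by simp)).congr_fun (eqOn_const k (Nat.le_of_lt_succ hk))
        measurableSet_Ioo
  rw [switchTime_zero, min_eq_left ht, min_eq_right hlt.le] at sum_integral
  rw [← sum_integral]
  refine Finset.sum_congr rfl fun k hk => ?_
  rw [intervalIntegral.integral_of_le (ordered k), integral_Ioc_eq_integral_Ioo,
    ← setIntegral_congr_fun measurableSet_Ioo
      (eqOn_const k (Nat.le_of_lt_succ (Finset.mem_range.1 hk))),
    setIntegral_const, smul_eq_mul, Real.volume_real_Ioo_of_le (ordered k), sojourn]

theorem posX_add_posY_eq_sum (c : ℝ) (hpos : ∀ k, 0 < τ k ω) (hle : switchTime τ n ω ≤ t)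
    (hlt : t < switchTime τ (n + 1) ω) :
    posX c τ ξ t ω + posY c τ ξ t ω =
      c * ∑ k ∈ Finset.range (n + 1), sojourn τ t k ω * (dirX (ξ k ω) + dirY (ξ k ω)) := by
  rw [posX, posY, integral_direction hpos (fun i => c * dirX i) hle hlt,
    integral_direction hpos (fun i => c * dirY i) hle hlt, ← Finset.sum_add_distrib,
    Finset.mul_sum]
  exact Finset.sum_congr rfl fun k _ => by ring

theorem posX_sub_posY_eq_sum (c : ℝ) (hpos : ∀ k, 0 < τ k ω) (hle : switchTime τ n ω ≤ t)
    (hlt : t < switchTime τ (n + 1) ω) :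
    posX c τ ξ t ω - posY c τ ξ t ω =
      c * ∑ k ∈ Finset.range (n + 1), sojourn τ t k ω * (dirX (ξ k ω) - dirY (ξ k ω)) := by
  rw [posX, posY, integral_direction hpos (fun i => c * dirX i) hle hlt,
    integral_direction hpos (fun i => c * dirY i) hle hlt, ← Finset.sum_sub_distrib,
    Finset.mul_sum]
  exact Finset.sum_congr rfl fun k _ => by ring

theorem posX_add_posY_eq_iff {c : ℝ} (hc : 0 < c) (hpos : ∀ k, 0 < τ k ω)
    (hne : ∀ k, ξ k ω ≠ ξ (k + 1) ω) (hlt : switchTime τ n ω < t)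
    (hlt' : t < switchTime τ (n + 1) ω) :
    posX c τ ξ t ω + posY c τ ξ t ω = c * t ↔
      ∃ e : Fin 2, ∀ k ≤ n, ξ k ω = alternatingDir (n + k + e) := by
  have term_le (k : ℕ) (hk : k ∈ Finset.range (n + 1)) :
      sojourn τ t k ω * (dirX (ξ k ω) + dirY (ξ k ω)) ≤ sojourn τ t k ω :=
    mul_le_of_le_one_right (sojourn_pos hpos hlt (Finset.mem_range_succ_iff.1 hk)).le
      (dirX_add_dirY_le_one _)
  have term_eq_iff (k : ℕ) (hk : k ≤ n) :
      sojourn τ t k ω * (dirX (ξ k ω) + dirY (ξ k ω)) = sojourn τ t k ω ↔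
        ξ k ω = 0 ∨ ξ k ω = 1 := by
    rw [mul_eq_left₀ (sojourn_pos hpos hlt hk).ne', dirX_add_dirY_eq_one_iff]
  have sum_eq_iff := Finset.sum_eq_sum_iff_of_le term_le
  rw [sum_sojourn ((switchTime_nonneg hpos n).trans hlt.le) hlt'] at sum_eq_iff
  rw [posX_add_posY_eq_sum c hpos hlt.le hlt', mul_right_inj' hc.ne', sum_eq_iff]
  simp only [Finset.mem_range_succ_iff]
  constructor
  · exact fun h => exists_eq_alternatingDir (fun k hk => (term_eq_iff k hk).1 (h k hk)) hne
  · rintro ⟨e, he⟩ k hk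
    rw [term_eq_iff k hk, he k hk]
    exact alternatingDir_eq_zero_or_one _

theorem posX_sub_posY_eq (c : ℝ) (hpos : ∀ k, 0 < τ k ω) (hle : switchTime τ n ω ≤ t)
    (hlt : t < switchTime τ (n + 1) ω) {e : ℕ}
    (halt : ∀ k ≤ n, ξ k ω = alternatingDir (n + k + e)) :
    posX c τ ξ t ω - posY c τ ξ t ω = c * ((-1) ^ e * (t - 2 * ∑ k ∈ oddGap n, τ k ω)) := by
  have ht : 0 ≤ t := (switchTime_nonneg hpos n).trans hle
  have sum_oddGap : ∑ k ∈ oddGap n, τ k ω = ∑ k ∈ oddGap n, sojourn τ t k ω :=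
    Finset.sum_congr rfl fun k hk =>
      (sojourn_of_lt hpos hle (Finset.mem_range.1 (Finset.mem_filter.1 hk).1)).symm
  have sum_alternating := sum_mul_neg_one_pow (fun k => sojourn τ t k ω) n
  rw [sum_sojourn ht hlt] at sum_alternating
  rw [posX_sub_posY_eq_sum c hpos hle hlt, sum_oddGap, ← sum_alternating,
    Finset.mul_sum _ _ ((-1) ^ e)]
  refine congrArg (c * ·) (Finset.sum_congr rfl fun k hk => ?_)
  rw [halt k (Finset.mem_range_succ_iff.1 hk), dirX_sub_dirY_alternatingDir]
  ring

end Path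

section Law

variable {Ω : Type*} {τ : ℕ → Ω → ℝ} {ξ : ℕ → Ω → Fin 4} {t : ℝ}

/-- The event that exactly `n` switches occur up to time `t`, between directions that alternate and
end with `alternatingDir e`, and that the time spent in the direction other than the last one lies
in `A`. -/
def alternatingEvent (τ : ℕ → Ω → ℝ) (ξ : ℕ → Ω → Fin 4) (t : ℝ) (n e : ℕ) (A : Set ℝ) : Set Ω :=
  {ω | (∀ k ≤ n, ξ k ω = alternatingDir (n + k + e)) ∧ ∑ i ∈ oddGap n, τ i ω ∈ A ∧
    switchTime τ n ω ≤ t ∧ t < switchTime τ (n + 1) ω}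

variable [MeasurableSpace Ω] {P : Measure Ω} {lam p : ℝ}

namespace IsPlanarMotion

theorem measurable_switchTime (h : IsPlanarMotion P lam p τ ξ) (n : ℕ) :
    Measurable (switchTime τ n) :=
  Finset.measurable_sum _ fun i _ => h.measurable_wait i

theorem measurableSet_switchTime_le_lt (h : IsPlanarMotion P lam p τ ξ) (t : ℝ) (n : ℕ) :
    MeasurableSet {ω | switchTime τ n ω ≤ t ∧ t < switchTime τ (n + 1) ω} :=
  (measurableSet_le (h.measurable_switchTime n) measurable_const).inter
    (measurableSet_lt measurable_const (h.measurable_switchTime (n + 1)))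

theorem measurableSet_alternatingEvent (h : IsPlanarMotion P lam p τ ξ) (t : ℝ) (n e : ℕ)
    {A : Set ℝ} (hA : MeasurableSet A) : MeasurableSet (alternatingEvent τ ξ t n e A) := by
  have measurableSet_dir : MeasurableSet {ω | ∀ k ≤ n, ξ k ω = alternatingDir (n + k + e)} := by
    simp only [Set.ofPred_forall]
    exact MeasurableSet.iInter fun k => MeasurableSet.iInter fun _ =>
      h.measurable_dir k (measurableSet_singleton _)
  exact measurableSet_dir.inter
    (((Finset.measurable_fun_sum _ fun i _ => h.measurable_wait i) hA).inter
      (h.measurableSet_switchTime_le_lt t n))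

theorem ae_wait_pos (h : IsPlanarMotion P lam p τ ξ) (hlam : 0 < lam) :
    ∀ᵐ ω ∂P, ∀ k, 0 < τ k ω :=
  ae_all_iff.2 fun k => ae_of_ae_map (h.measurable_wait k).aemeasurable
    (h.wait_law k ▸ ae_pos_expMeasure hlam)

theorem aedisjoint_switchTime_le_lt (h : IsPlanarMotion P lam p τ ξ) (hlam : 0 < lam) (t : ℝ) :
    Pairwise (Function.onFun (AEDisjoint P)
      fun n => {ω | switchTime τ n ω ≤ t ∧ t < switchTime τ (n + 1) ω}) := fun m n hmn => by
  refine measure_eq_zero_iff_ae_notMem.2 ?_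
  filter_upwards [h.ae_wait_pos hlam] with ω hpos hmem
  exact hmn ((switchCount_eq hpos hmem.1.1 hmem.1.2).symm.trans
    (switchCount_eq hpos hmem.2.1 hmem.2.2))

theorem aedisjoint_alternatingEvent (h : IsPlanarMotion P lam p τ ξ) (hlam : 0 < lam) (t : ℝ)
    (A : ℕ × Fin 2 → Set ℝ) :
    Pairwise (Function.onFun (AEDisjoint P)
      fun q => alternatingEvent τ ξ t (q.1 + 1) q.2 (A q)) := by
  rintro ⟨m, d⟩ ⟨n, e⟩ hne
  by_cases hmn : m = n
  · subst hmn
    refine (Set.disjoint_left.2 fun ω hd he => hne ?_).aedisjoint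
    have last_eq := (hd.1 _ le_rfl).symm.trans (he.1 _ le_rfl)
    fin_cases d <;> fin_cases e <;> simp [alternatingDir, Nat.even_add_one] at last_eq ⊢
  · exact (h.aedisjoint_switchTime_le_lt hlam t (by simpa using hmn)).mono
      (fun _ hω => hω.2.2) (fun _ hω => hω.2.2)

variable [IsProbabilityMeasure P]

theorem measure_switchTime_le_lt (h : IsPlanarMotion P lam p τ ξ) (hlam : 0 < lam) (ht : 0 ≤ t)
    (n : ℕ) :
    P {ω | switchTime τ n ω ≤ t ∧ t < switchTime τ (n + 1) ω} =
      ENNReal.ofReal (poissonWeight n (lam * t)) := by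
  have measure_eq := measure_sum_mem_and_sum_le_lt hlam h.measurable_wait h.wait_law h.wait_indep
    (Finset.disjoint_empty_left (Finset.range n)) (Finset.notMem_empty n) Finset.notMem_range_self
    t MeasurableSet.univ
  simp_rw [switchTime_succ]
  simpa [switchTime, erlangMeasure, gammaPDF_natCast_add_one hlam.le n ht,
    ← ENNReal.ofReal_inv_of_pos hlam, ← ENNReal.ofReal_mul, hlam.le, hlam.ne'] using measure_eq

theorem ae_exists_switchTime_le_lt (h : IsPlanarMotion P lam p τ ξ) (hlam : 0 < lam)
    (ht : 0 ≤ t) : ∀ᵐ ω ∂P, ∃ n, switchTime τ n ω ≤ t ∧ t < switchTime τ (n + 1) ω := by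
  have measure_iUnion : P (⋃ n, {ω | switchTime τ n ω ≤ t ∧ t < switchTime τ (n + 1) ω}) = 1 := by
    rw [measure_iUnion₀ (h.aedisjoint_switchTime_le_lt hlam t)
      fun n => (h.measurableSet_switchTime_le_lt t n).nullMeasurableSet]
    simp_rw [h.measure_switchTime_le_lt hlam ht]
    rw [← ENNReal.ofReal_tsum_of_nonneg
      (fun n => poissonWeight_nonneg n (mul_nonneg hlam.le ht)) (hasSum_poissonWeight _).summable,
      (hasSum_poissonWeight _).tsum_eq, ENNReal.ofReal_one]
  rw [← mem_ae_iff_prob_eq_one (.iUnion (h.measurableSet_switchTime_le_lt t))] at measure_iUnion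
  filter_upwards [measure_iUnion] with ω hω
  exact Set.mem_iUnion.1 hω

theorem ae_switchTime_ne (h : IsPlanarMotion P lam p τ ξ) (hlam : 0 < lam) (ht : t ≠ 0) :
    ∀ᵐ ω ∂P, ∀ n, switchTime τ n ω ≠ t := by
  refine ae_all_iff.2 fun n => ?_
  cases n with
  | zero => exact .of_forall fun ω => by rwa [switchTime_zero, ne_comm]
  | succ k =>
    have map_switchTime : P.map (switchTime τ (k + 1)) = gammaMeasure (k + 1) lam := by
      have map_sum := map_sum_eq_erlangMeasure hlam h.measurable_wait h.wait_law h.wait_indep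
        (Finset.range (k + 1))
      rwa [Finset.card_range, Finset.sum_fn] at map_sum
    refine ae_of_ae_map (p := (· ≠ t)) (h.measurable_switchTime (k + 1)).aemeasurable ?_
    rw [map_switchTime, gammaMeasure]
    exact (withDensity_absolutelyContinuous _ _).ae_le (Measure.ae_ne volume t)

theorem ae_dir_ne (h : IsPlanarMotion P lam p τ ξ) : ∀ᵐ ω ∂P, ∀ k, ξ k ω ≠ ξ (k + 1) ω := by
  refine ae_all_iff.2 fun k => ?_
  have ae_path_ne (b : Fin (k + 2) → Fin 4) (hb : b (.ofNat _ k) = b (.ofNat _ (k + 1))) :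
      ∀ᵐ ω ∂P, ¬ ∀ m ≤ k + 1, ξ m ω = b (.ofNat _ m) := by
    have path_law := h.dir_law (k + 1) fun m => b (.ofNat _ m)
    rw [Finset.prod_range_succ, hb, turnProb_self, mul_zero, mul_zero] at path_law
    exact measure_eq_zero_iff_ae_notMem.1 ((measureReal_eq_zero_iff).1 path_law)
  have ae_forall_path := ae_all_iff.2 fun b =>
    Filter.eventually_imp_distrib_left.2 (ae_path_ne b)
  filter_upwards [ae_forall_path] with ω hω heq
  refine hω (fun i => ξ i ω) ?_ fun m hm => ?_
  · simpa [Nat.mod_eq_of_lt (show k < k + 2 by omega)] using heq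
  · simp [Nat.mod_eq_of_lt (Nat.lt_succ_of_le hm)]

theorem measure_dir_eq_alternatingDir (h : IsPlanarMotion P lam p τ ξ) (n e : ℕ) :
    P {ω | ∀ k ≤ n, ξ k ω = alternatingDir (n + k + e)} = ENNReal.ofReal (1 / 4 * p ^ n) := by
  have turnProb_eq (k : ℕ) :
      turnProb p (alternatingDir (n + k + e)) (alternatingDir (n + (k + 1) + e)) = p := by
    rw [show n + (k + 1) + e = n + k + e + 1 by ring, turnProb_alternatingDir]
  rw [← ofReal_measureReal, h.dir_law n fun k => alternatingDir (n + k + e)]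
  simp_rw [turnProb_eq, Finset.prod_const, Finset.card_range]

theorem measure_sum_oddGap_mem (h : IsPlanarMotion P lam p τ ξ) (hlam : 0 < lam) (n : ℕ)
    {A : Set ℝ} (hA : MeasurableSet A) (hAt : A ⊆ Set.Icc 0 t) :
    P {ω | ∑ i ∈ oddGap (n + 1), τ i ω ∈ A ∧ switchTime τ (n + 1) ω ≤ t ∧
        t < switchTime τ (n + 1 + 1) ω} =
      ∫⁻ u in A, ENNReal.ofReal (occupationDensity lam n u (t - u)) := by
  obtain ⟨card_odd, card_even⟩ := card_oddGap_and_card_evenGap (n + 1)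
  have measure_eq := measure_sum_mem_and_sum_le_lt hlam h.measurable_wait h.wait_law h.wait_indep
    (disjoint_oddGap_evenGap (n + 1)) (self_notMem_oddGap _) (self_notMem_evenGap _) t hA
  rw [card_odd, card_even, show (n + 1 + 1) / 2 = n / 2 + 1 by omega,
    setLIntegral_gammaPDF_sub_erlangMeasure hlam _ _ hA hAt] at measure_eq
  simp_rw [sum_oddGap_add_sum_evenGap] at measure_eq
  simp_rw [switchTime_succ (n + 1)]
  exact measure_eq

theorem measure_alternatingEvent (h : IsPlanarMotion P lam p τ ξ) (hlam : 0 < lam) (n e : ℕ)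
    {A : Set ℝ} (hA : MeasurableSet A) (hAt : A ⊆ Set.Icc 0 t) :
    P (alternatingEvent τ ξ t (n + 1) e A) = ENNReal.ofReal (1 / 4 * p ^ (n + 1)) *
      ∫⁻ u in A, ENNReal.ofReal (occupationDensity lam n u (t - u)) := by
  have measurable_sum (S : Finset ℕ) : Measurable fun v : ℕ → ℝ => ∑ i ∈ S, v i :=
    Finset.measurable_sum S fun i _ => measurable_pi_apply i
  have measurableSet_wait : MeasurableSet {v : ℕ → ℝ | ∑ i ∈ oddGap (n + 1), v i ∈ A ∧
      ∑ i ∈ Finset.range (n + 1), v i ≤ t ∧ t < ∑ i ∈ Finset.range (n + 1 + 1), v i} :=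
    (measurable_sum _ hA).inter ((measurableSet_le (measurable_sum _) measurable_const).inter
      (measurableSet_lt measurable_const (measurable_sum _)))
  have measurableSet_dir :
      MeasurableSet {x : ℕ → Fin 4 | ∀ k ≤ n + 1, x k = alternatingDir (n + 1 + k + e)} := by
    simp only [Set.ofPred_forall]
    exact MeasurableSet.iInter fun k => MeasurableSet.iInter fun _ =>
      measurable_pi_apply k (measurableSet_singleton _)
  rw [← h.measure_dir_eq_alternatingDir (n + 1) e, ← h.measure_sum_oddGap_mem hlam n hA hAt]
  exact h.wait_dir_indep.symm.measure_inter_preimage_eq_mul _ _ measurableSet_dir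
    measurableSet_wait

theorem ae_mem_boundary_iff (h : IsPlanarMotion P lam p τ ξ) (hlam : 0 < lam) {c : ℝ}
    (hc : 0 < c) (ht : 0 < t) {B : Set ℝ} (hB : B ⊆ Set.Ioo (-(c * t)) (c * t)) :
    ∀ᵐ ω ∂P, (posX c τ ξ t ω + posY c τ ξ t ω = c * t ∧ posX c τ ξ t ω - posY c τ ξ t ω ∈ B) ↔
      ω ∈ ⋃ q : ℕ × Fin 2, alternatingEvent τ ξ t (q.1 + 1) q.2
        ((fun u => c * ((-1) ^ (q.2 : ℕ) * (t - 2 * u))) ⁻¹' B) := by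
  filter_upwards [h.ae_wait_pos hlam, h.ae_switchTime_ne hlam ht.ne',
    h.ae_exists_switchTime_le_lt hlam ht.le, h.ae_dir_ne] with ω hpos hT hex hne
  simp only [Set.mem_iUnion, Prod.exists]
  constructor
  · rintro ⟨hsum, hdiff⟩
    obtain ⟨n, hle, hlt⟩ := hex
    obtain ⟨e, halt⟩ := (posX_add_posY_eq_iff hc hpos hne (hle.lt_of_ne (hT n)) hlt).1 hsum
    rw [posX_sub_posY_eq c hpos hle hlt halt] at hdiff
    cases n with
    | zero =>
      -- Without a switch, `X - Y = ± c t` is an end point of the open interval.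
      have hmem := hB hdiff
      fin_cases e <;> simp [oddGap] at hmem
    | succ n => exact ⟨n, e, halt, hdiff, hle, hlt⟩
  · rintro ⟨n, e, halt, hdiff, hle, hlt⟩
    refine ⟨(posX_add_posY_eq_iff hc hpos hne (hle.lt_of_ne (hT _)) hlt).2 ⟨e, halt⟩, ?_⟩
    rwa [posX_sub_posY_eq c hpos hle hlt halt]

end IsPlanarMotion

end Law

theorem setLIntegral_preimage_affine {a : ℝ} (b : ℝ) (ha : a ≠ 0) {B : Set ℝ}
    (hB : MeasurableSet B) (f : ℝ → ENNReal) :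
    ∫⁻ x in (fun x => a * x + b) ⁻¹' B, f x =
      ∫⁻ y in B, ENNReal.ofReal |1 / a| * f ((y - b) / a) := by
  have image_eq : (affineHomeomorph a b ha).symm '' B = (fun x => a * x + b) ⁻¹' B :=
    (affineHomeomorph a b ha).toEquiv.image_symm_eq_preimage B
  rw [← image_eq]
  exact lintegral_image_eq_lintegral_abs_deriv_mul hB
    (fun y _ => (((hasDerivAt_id y).sub_const b).div_const a).hasDerivWithinAt)
    (affineHomeomorph a b ha).symm.injective.injOn f

section Density

variable {c lam p t η : ℝ}

/-- The contribution to `boundaryDensity` of the paths with `n + 1` switches whose directions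
alternate and end with `alternatingDir e`. -/
noncomputable def alternatingDensity (c lam p t : ℝ) (n e : ℕ) (η : ℝ) : ℝ :=
  1 / 4 * p ^ (n + 1) / (2 * c) *
    occupationDensity lam n ((t - (-1) ^ e * η / c) / 2) ((t + (-1) ^ e * η / c) / 2)

theorem measurable_alternatingDensity (c lam p t : ℝ) (n e : ℕ) :
    Measurable (alternatingDensity c lam p t n e) := by
  unfold alternatingDensity occupationDensity poissonWeight
  fun_prop

theorem abs_neg_one_pow_mul_div_lt (hc : 0 < c) (hη : η ∈ Set.Ioo (-(c * t)) (c * t)) (e : ℕ) :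
    |(-1) ^ e * η / c| < t := by
  rw [abs_div, abs_mul, abs_neg_one_pow, one_mul, abs_of_pos hc, div_lt_iff₀ hc, mul_comm t]
  exact abs_lt.2 hη

theorem alternatingDensity_nonneg (hc : 0 < c) (hlam : 0 ≤ lam) (hp : 0 ≤ p)
    (hη : η ∈ Set.Ioo (-(c * t)) (c * t)) (n e : ℕ) : 0 ≤ alternatingDensity c lam p t n e η := by
  obtain ⟨neg_lt, lt⟩ := abs_lt.1 (abs_neg_one_pow_mul_div_lt hc hη e)
  exact mul_nonneg (by positivity)
    (occupationDensity_nonneg n hlam (by linarith) (by linarith))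

theorem hasSum_alternatingDensity (lam p : ℝ) (hc : 0 < c)
    (hη : η ∈ Set.Ioo (-(c * t)) (c * t)) :
    HasSum (fun n => alternatingDensity c lam p t n 0 η + alternatingDensity c lam p t n 1 η)
      (boundaryDensity c lam p η t) := by
  have hasSum_end_zero :=
    hasSum_pow_mul_occupationDensity lam p ((t - η / c) / 2) ((t + η / c) / 2)
  have hasSum_end_one :=
    hasSum_pow_mul_occupationDensity lam p ((t + η / c) / 2) ((t - η / c) / 2)
  rw [show (t - η / c) / 2 + (t + η / c) / 2 = t by ring] at hasSum_end_zero
  rw [show (t + η / c) / 2 + (t - η / c) / 2 = t by ring,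
    mul_comm ((t + η / c) / 2) ((t - η / c) / 2)] at hasSum_end_one
  rw [boundaryDensity_eq lam p hc hη]
  convert (hasSum_end_zero.add hasSum_end_one).mul_left (1 / (8 * c)) using 1
  · rfl
  · ext n
    simp only [alternatingDensity, pow_zero, pow_one, one_mul, neg_one_mul, neg_div,
      sub_neg_eq_add, ← sub_eq_add_neg]
    ring
  · ring

theorem boundaryDensity_nonneg (hc : 0 < c) (hlam : 0 ≤ lam) (hp : 0 ≤ p)
    (hη : η ∈ Set.Ioo (-(c * t)) (c * t)) : 0 ≤ boundaryDensity c lam p η t :=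
  (hasSum_alternatingDensity lam p hc hη).nonneg fun n =>
    add_nonneg (alternatingDensity_nonneg hc hlam hp hη n 0)
      (alternatingDensity_nonneg hc hlam hp hη n 1)

theorem tsum_ofReal_alternatingDensity (hc : 0 < c) (hlam : 0 ≤ lam) (hp : 0 ≤ p)
    (hη : η ∈ Set.Ioo (-(c * t)) (c * t)) :
    ∑' q : ℕ × Fin 2, ENNReal.ofReal (alternatingDensity c lam p t q.1 q.2 η) =
      ENNReal.ofReal (boundaryDensity c lam p η t) := by
  have nonneg := alternatingDensity_nonneg hc hlam hp hη
  have hasSum := hasSum_alternatingDensity lam p hc hη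
  rw [← hasSum.tsum_eq, ENNReal.ofReal_tsum_of_nonneg
    (fun n => add_nonneg (nonneg n 0) (nonneg n 1)) hasSum.summable, ENNReal.tsum_prod']
  refine tsum_congr fun n => ?_
  rw [tsum_fintype, Fin.sum_univ_two, ENNReal.ofReal_add (nonneg n 0) (nonneg n 1)]
  rfl

namespace IsPlanarMotion

variable {Ω : Type*} [MeasurableSpace Ω] {P : Measure Ω} [IsProbabilityMeasure P]
  {τ : ℕ → Ω → ℝ} {ξ : ℕ → Ω → Fin 4} {B : Set ℝ}

theorem measure_alternatingEvent_preimage (h : IsPlanarMotion P lam p τ ξ) (hc : 0 < c)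
    (hlam : 0 < lam) (hp : 0 ≤ p) (hBm : MeasurableSet B)
    (hB : B ⊆ Set.Ioo (-(c * t)) (c * t)) (n e : ℕ) :
    P (alternatingEvent τ ξ t (n + 1) e ((fun u => c * ((-1) ^ e * (t - 2 * u))) ⁻¹' B)) =
      ∫⁻ η in B, ENNReal.ofReal (alternatingDensity c lam p t n e η) := by
  have sq_sign : ((-1 : ℝ) ^ e) ^ 2 = 1 := by rw [← pow_mul, mul_comm, pow_mul, neg_one_sq, one_pow]
  have sign_ne_zero : (-1 : ℝ) ^ e ≠ 0 := pow_ne_zero _ (by norm_num)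
  have preimage_subset : (fun u => c * ((-1) ^ e * (t - 2 * u))) ⁻¹' B ⊆ Set.Icc 0 t := by
    intro u hu
    have abs_lt_t := abs_neg_one_pow_mul_div_lt hc (hB hu) e
    rw [show (-1) ^ e * (c * ((-1) ^ e * (t - 2 * u))) / c = t - 2 * u by
      field_simp
      linear_combination (t - 2 * u) * sq_sign, abs_lt] at abs_lt_t
    constructor <;> linarith
  rw [h.measure_alternatingEvent hlam n e ((by fun_prop : Measurable fun u : ℝ =>
    c * ((-1) ^ e * (t - 2 * u))) hBm) preimage_subset]
  have affine_eq : (fun u => c * ((-1) ^ e * (t - 2 * u))) =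
      fun u => -(2 * c * (-1) ^ e) * u + c * ((-1) ^ e * t) := by
    ext u
    ring
  have abs_slope : |1 / -(2 * c * (-1) ^ e)| = 1 / (2 * c) := by
    rw [abs_div, abs_neg, abs_mul, abs_neg_one_pow, abs_one, mul_one, abs_of_pos (by positivity)]
  rw [affine_eq, setLIntegral_preimage_affine _ (by simp [hc.ne']) hBm, abs_slope,
    ← lintegral_const_mul' _ _ ENNReal.ofReal_ne_top]
  refine lintegral_congr fun η => ?_
  have inverse_eq : (η - c * ((-1) ^ e * t)) / -(2 * c * (-1) ^ e) =
      (t - (-1) ^ e * η / c) / 2 := by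
    field_simp
    linear_combination η * sq_sign
  rw [inverse_eq, show t - (t - (-1) ^ e * η / c) / 2 = (t + (-1) ^ e * η / c) / 2 by ring,
    ← mul_assoc, ← ENNReal.ofReal_mul (by positivity), ← ENNReal.ofReal_mul (by positivity),
    alternatingDensity, mul_one_div]

theorem measure_boundary (h : IsPlanarMotion P lam p τ ξ) (hc : 0 < c) (hlam : 0 < lam)
    (hp : 0 ≤ p) (ht : 0 < t) (hBm : MeasurableSet B) (hB : B ⊆ Set.Ioo (-(c * t)) (c * t)) :
    P {ω | posX c τ ξ t ω + posY c τ ξ t ω = c * t ∧ posX c τ ξ t ω - posY c τ ξ t ω ∈ B} =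
      ∫⁻ η in B, ENNReal.ofReal (boundaryDensity c lam p η t) := by
  have measurableSet_preimage (e : ℕ) :
      MeasurableSet ((fun u : ℝ => c * ((-1) ^ e * (t - 2 * u))) ⁻¹' B) :=
    (by fun_prop : Measurable fun u : ℝ => c * ((-1) ^ e * (t - 2 * u))) hBm
  have boundary_ae_eq :
      {ω | posX c τ ξ t ω + posY c τ ξ t ω = c * t ∧ posX c τ ξ t ω - posY c τ ξ t ω ∈ B} =ᵐ[P]
        ⋃ q : ℕ × Fin 2, alternatingEvent τ ξ t (q.1 + 1) q.2
          ((fun u => c * ((-1) ^ (q.2 : ℕ) * (t - 2 * u))) ⁻¹' B) :=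
    Filter.eventuallyEq_set.2 (h.ae_mem_boundary_iff hlam hc ht hB)
  calc
    _ = ∑' q : ℕ × Fin 2, P (alternatingEvent τ ξ t (q.1 + 1) q.2
          ((fun u => c * ((-1) ^ (q.2 : ℕ) * (t - 2 * u))) ⁻¹' B)) := by
      rw [measure_congr boundary_ae_eq, measure_iUnion₀ (h.aedisjoint_alternatingEvent hlam t _)]
      exact fun q => (h.measurableSet_alternatingEvent t _ _
        (measurableSet_preimage q.2)).nullMeasurableSet
    _ = ∑' q : ℕ × Fin 2, ∫⁻ η in B, ENNReal.ofReal (alternatingDensity c lam p t q.1 q.2 η) :=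
      tsum_congr fun q => h.measure_alternatingEvent_preimage hc hlam hp hBm hB q.1 q.2
    _ = ∫⁻ η in B, ∑' q : ℕ × Fin 2, ENNReal.ofReal (alternatingDensity c lam p t q.1 q.2 η) :=
      (lintegral_tsum fun q : ℕ × Fin 2 =>
        (measurable_alternatingDensity c lam p t q.1 q.2).ennreal_ofReal.aemeasurable).symm
    _ = ∫⁻ η in B, ENNReal.ofReal (boundaryDensity c lam p η t) :=
      setLIntegral_congr_fun hBm fun η hη =>
        tsum_ofReal_alternatingDensity hc hlam.le hp (hB hη)

end IsPlanarMotion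

end Density

theorem theorem5 {Ω : Type*} [MeasurableSpace Ω] (P : Measure Ω) [IsProbabilityMeasure P]
    (c lam p : ℝ) (hc : 0 < c) (hlam : 0 < lam) (hp0 : 0 < p) (hp1 : p < 1)
    (τ : ℕ → Ω → ℝ) (ξ : ℕ → Ω → Fin 4) (h : IsPlanarMotion P lam p τ ξ)
    (t : ℝ) (ht : 0 < t) :
    (∀ η ∈ Set.Ioo (-(c * t)) (c * t),
      DifferentiableAt ℝ
        (fun s : ℝ => besselI0 (lam * p / c * √(c ^ 2 * s ^ 2 - η ^ 2))) t ∧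
      0 ≤ boundaryDensity c lam p η t) ∧
    IntegrableOn (fun η => boundaryDensity c lam p η t) (Set.Ioo (-(c * t)) (c * t)) ∧
    ∀ B : Set ℝ, MeasurableSet B → B ⊆ Set.Ioo (-(c * t)) (c * t) →
      P.real {ω | posX c τ ξ t ω + posY c τ ξ t ω = c * t ∧
          posX c τ ξ t ω - posY c τ ξ t ω ∈ B} =
        ∫ η in B, boundaryDensity c lam p η t := by
  have nonneg : ∀ η ∈ Set.Ioo (-(c * t)) (c * t), 0 ≤ boundaryDensity c lam p η t :=
    fun η hη => boundaryDensity_nonneg hc hlam.le hp0.le hη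
  have integrableOn := integrableOn_boundaryDensity lam p t hc
  refine ⟨fun η hη => ⟨(hasDerivAt_besselI0_lightCone _ hη).differentiableAt, nonneg η hη⟩,
    integrableOn, fun B hBm hB => ?_⟩
  rw [measureReal_def, h.measure_boundary hc hlam hp0.le ht hBm hB,
    integral_eq_lintegral_of_nonneg_ae
      ((ae_restrict_mem hBm).mono fun η hη => nonneg η (hB hη))
      (integrableOn.mono_set hB).aestronglyMeasurable]
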